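/- For a Young diagram $\lambda$ with $n$ boxes let $\rho^\lambda$ be the corresponding irreducible complex representation of the symmetric group $S_n$ (realized on the left ideal $\mathbb{C}[S_n]\,b_\lambda a_\lambda$ generated by the Young symmetrizer, where, after numbering the boxes of $\lambda$, $a_\lambda$ is the sum of the row-preserving permutations and $b_\lambda$ is the signed sum of the column-preserving permutations). For $l\le n$ and $\pi\in S_l$, with $\pi$ regarded as an element of $S_n$ fixing $l+1,\dots,n$, define the normalized character $$\Sigma^{\lambda}(\pi)=n(n-1)\cdots(n-l+1)\,\frac{\operatorname{Tr}\rho^{\lambda}(\pi)}{\operatorname{Tr}\rho^{\lambda}(e)}.$$ Let $\mathbf p=(p_1,\dots,p_r)$ and $\mathbf q=(q_1,\dots,q_r)$ be sequences of positive integers with $q_1\ge\cdots\ge q_r$, and let $$\mathbf p\times\mathbf q=(\underbrace{q_1,\dots,q_1}_{p_1\text{ times}},\underbrace{q_2,\dots,q_2}_{p_2\text{ times}},\dots,\underbrace{q_r,\dots,q_r}_{p_r\text{ times}})$$ be the multirectangular partition, which has $n=p_1q_1+\cdots+p_rq_r$ boxes. Denote by $C(\sigma)$ the set of cycles of a permutation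 $\sigma$ (fixed points included). Let $S(l)^{(r)}$ be the set of colored permutations, i.e. pairs $(\sigma,\varphi)$ with $\sigma\in S_l$ and $\varphi:\{1,\dots,l\}\to\{1,\dots,r\}$ constant on each cycle of $\sigma$; write $\varphi(b)$ for the value of $\varphi$ on a cycle $b\in C(\sigma)$. **Theorem (Stanley–Féray character formula).** For every $l\le n$ and every $\pi\in S_l$, $$\Sigma^{\mathbf p\times\mathbf q}(\pi)=(-1)^l\sum_{(\sigma,\varphi)\in S(l)^{(r)}}\ \prod_{b\in C(\sigma)}p_{\varphi(b)}\ \prod_{c\in C(\sigma\pi)}\bigl(-q_{\psi(c)}\bigr),$$ where, for each $(\sigma,\varphi)$, the coloring $\psi$ of the cycles of $\sigma\pi$ is given by $\psi(c)=\max_{a\in c}\varphi(a)$ for $c\in C(\sigma\pi)$. -/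

import Mathlib

namespace StanleyFeray

noncomputable section

/-! ## The irreducible representation attached to a Young diagram

Young diagrams are Mathlib's `YoungDiagram`: a box is a pair `(i, j)` with `i` the index of its row
and `j` the index of its column (both counted from zero). -/

/-- The set of boxes of `μ`, as a type. -/
abbrev Box (μ : YoungDiagram) : Type := {x : ℕ × ℕ // x ∈ μ.cells}

/-- The permutations of the boxes of `μ` that preserve each row. -/
def rowStabilizer (μ : YoungDiagram) : Finset (Equiv.Perm (Box μ)) :=
  Finset.univ.filter fun σ => ∀ x : Box μ, (σ x).1.1 = x.1.1

/-- The permutations of the boxes of `μ` that preserve each column. -/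
def colStabilizer (μ : YoungDiagram) : Finset (Equiv.Perm (Box μ)) :=
  Finset.univ.filter fun σ => ∀ x : Box μ, (σ x).1.2 = x.1.2

/-- `a_μ`, the sum of all row-preserving permutations in the group algebra. -/
def rowSymmetrizer (μ : YoungDiagram) : MonoidAlgebra ℂ (Equiv.Perm (Box μ)) :=
  ∑ σ ∈ rowStabilizer μ, MonoidAlgebra.single σ (1 : ℂ)

/-- `b_μ`, the signed sum of all column-preserving permutations in the group algebra. -/
def colAntisymmetrizer (μ : YoungDiagram) : MonoidAlgebra ℂ (Equiv.Perm (Box μ)) :=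
  ∑ σ ∈ colStabilizer μ, MonoidAlgebra.single σ (((Equiv.Perm.sign σ : ℤ)) : ℂ)

/-- The Young symmetrizer `c_μ = b_μ a_μ`. -/
def youngSymmetrizer (μ : YoungDiagram) : MonoidAlgebra ℂ (Equiv.Perm (Box μ)) :=
  colAntisymmetrizer μ * rowSymmetrizer μ

/-- The left ideal of the group algebra generated by the Young symmetrizer (`Ideal` means left
ideal over a noncommutative ring). -/
abbrev spechtModule (μ : YoungDiagram) : Ideal (MonoidAlgebra ℂ (Equiv.Perm (Box μ))) :=
  Ideal.span {youngSymmetrizer μ}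

/-- The symmetric group on the boxes of `μ` acting on the left ideal by left multiplication. -/
def boxRep (μ : YoungDiagram) :
    Representation ℂ (Equiv.Perm (Box μ)) (spechtModule μ) :=
  Representation.ofModule' (spechtModule μ)

/-- A numbering of the boxes of `μ`. Another numbering leads to an isomorphic representation of the
symmetric group on `μ.card` letters. -/
def numbering (μ : YoungDiagram) : Fin μ.card ≃ Box μ :=
  μ.cells.equivFin.symm

/-- The irreducible representation `ρ^μ` of the symmetric group `S_n`, where `n` is the number of
boxes of `μ`. -/
def rho (μ : YoungDiagram) :
    Representation ℂ (Equiv.Perm (Fin μ.card)) (spechtModule μ) :=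
  (boxRep μ).comp (numbering μ).permCongrHom.toMonoidHom

/-- The character `Tr ρ^μ(g) / Tr ρ^μ(e)`. -/
def chi (μ : YoungDiagram) (g : Equiv.Perm (Fin μ.card)) : ℂ :=
  (rho μ).character g / (rho μ).character 1

/-- The normalized character `Σ^μ(π) = (n)_l χ^μ(π)` for `π ∈ S_l` and `l ≤ n`, where `π` acts on
the first `l` of the `n` letters and fixes the others. -/
def normalizedCharacter (μ : YoungDiagram) {l : ℕ} (hl : l ≤ μ.card)
    (π : Equiv.Perm (Fin l)) : ℂ :=
  (μ.card.descFactorial l : ℂ) * chi μ (π.viaFintypeEmbedding (Fin.castLEEmb hl))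

/-! ## Multirectangular diagrams -/

/-- The list `q₁, …, q₁, q₂, …, q₂, …` in which `qᵢ` is repeated `pᵢ` times. -/
def multirectRows {r : ℕ} (p q : Fin r → ℕ) : List ℕ :=
  (List.ofFn fun i => List.replicate (p i) (q i)).flatten

theorem multirectRows_sorted {r : ℕ} (p q : Fin r → ℕ) (hq : Antitone q) :
    (multirectRows p q).SortedGE := by
  rw [List.sortedGE_iff_pairwise, multirectRows, List.pairwise_flatten]
  constructor
  · intro l hl
    obtain ⟨i, rfl⟩ := (List.mem_ofFn' _ _).1 hl
    simp [List.pairwise_replicate]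
  · rw [List.pairwise_ofFn]
    intro i j hij x hx y hy
    rw [List.eq_of_mem_replicate hx, List.eq_of_mem_replicate hy]
    exact hq hij.le

/-- The diagram `p × q` with `p₁` rows of length `q₁`, then `p₂` rows of length `q₂`, and so on. -/
def multirect {r : ℕ} (p q : Fin r → ℕ) (hq : Antitone q) : YoungDiagram :=
  YoungDiagram.ofRowLens (multirectRows p q) (multirectRows_sorted p q hq)

/-! ## Colored permutations -/

/-- `C(σ)`, the set of cycles of `σ`, fixed points included. -/
abbrev Cycles {l : ℕ} (σ : Equiv.Perm (Fin l)) : Type :=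
  Quotient (Equiv.Perm.SameCycle.setoid σ)

instance cyclesFintype {l : ℕ} (σ : Equiv.Perm (Fin l)) : Fintype (Cycles σ) :=
  Fintype.ofFinite _

/-- `S(l)^{(r)}`: pairs of a permutation and a coloring of the letters that is constant on each of
its cycles. -/
abbrev ColoredPerm (l r : ℕ) : Type :=
  {x : Equiv.Perm (Fin l) × (Fin l → Fin r) //
    ∀ a b, x.1.SameCycle a b → x.2 a = x.2 b}

namespace ColoredPerm

variable {l r : ℕ}

/-- The underlying permutation. -/
abbrev perm (x : ColoredPerm l r) : Equiv.Perm (Fin l) := x.1.1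

/-- The coloring, as a function on the set of cycles. -/
def color (x : ColoredPerm l r) (c : Cycles (perm x)) : Fin r :=
  Quotient.lift x.1.2 (fun a b h => x.2 a b h) c

/-- The product `(σ, φ) · π = (σ π, ψ)`: the color of `a` is the maximum of `φ` over the cycle of
`σ π` that contains `a`. -/
def mulPerm (x : ColoredPerm l r) (π : Equiv.Perm (Fin l)) : ColoredPerm l r :=
  ⟨(perm x * π, fun a =>
      (Finset.univ.filter fun b => (perm x * π).SameCycle a b).sup'
        ⟨a, by simp [Equiv.Perm.SameCycle.refl]⟩ x.1.2),
    fun a b h => by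
      have key : (Finset.univ.filter fun c => (perm x * π).SameCycle a c) =
          Finset.univ.filter fun c => (perm x * π).SameCycle b c := by
        ext c
        simp only [Finset.mem_filter, Finset.mem_univ, true_and]
        exact ⟨fun hc => h.symm.trans hc, fun hc => h.trans hc⟩
      exact Finset.sup'_congr ⟨a, by simp [Equiv.Perm.SameCycle.refl]⟩ key fun _ _ => rfl⟩

end ColoredPerm

end

end StanleyFeray

/-!
The Young symmetrizer `c` satisfies `c * c = α • c` with `α ≠ 0`, so `x ↦ α⁻¹ • (x * c)` projects
the group algebra onto the left ideal of `c`, and `χ(g) / χ(1)` is the average over `h` of the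
coefficient of `c` at `h⁻¹ g⁻¹ h`. For `g` a permutation `π` of `l` letters, averaging over `h`
amounts to summing over all injective placements of the `l` letters in the boxes. The coefficient
attached to a placement is the sum of the signs of `σ π` over those `σ` that preserve the rows of
the letters while `σ π` preserves their columns. This signed sum makes sense for placements that
are not injective too, and there it vanishes: if two letters share a box, composing `σ` with their
transposition reverses the sign. So all maps from letters to boxes may be counted, and such a map
is a row for each letter, constant on the cycles of `σ`, together with a column for each letter,
constant on the cycles of `σ π`. In the shape `p × q`, letting `φ` record the block of the chosen
row, there are `p_φ(b)` rows for a cycle `b` of `σ`, and the columns allowed for a cycle `c` of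
`σ π` are those that exist in the shortest of the rows met by `c`; since `q` decreases, their number
is `q_ψ(c)`.
-/

namespace StanleyFeray

open Equiv Finset
open LinearMap (trace mulLeftRight)

noncomputable section

section QuasiIdempotent

variable {k A : Type*} [Field k] [Ring A] [Algebra k A] [Module.Finite k A]

theorem trace_lsmul_span_singleton {c : A} {α : k} (hα : α ≠ 0) (hc : c * c = α • c) (a : A) :
    trace k _ (Algebra.lsmul k k (Ideal.span {c} : Ideal A) a)
      = α⁻¹ * trace k A (mulLeftRight k (a, c)) := by
  let I : Submodule k A := (Ideal.span {c} : Ideal A).restrictScalars k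
  let f : A →ₗ[k] A := α⁻¹ • mulLeftRight k (a, c)
  have hf_mem (x : A) : f x ∈ I :=
    I.smul_mem _ (Ideal.mul_mem_left _ (a * x) (Ideal.mem_span_singleton_self c))
  have hf_restrict :
      f.restrict (p := I) (q := I) (fun x _ => hf_mem x)
        = Algebra.lsmul k k (Ideal.span {c} : Ideal A) a := by
    ext ⟨x, hx⟩
    obtain ⟨y, rfl⟩ := Ideal.mem_span_singleton'.1 hx
    change α⁻¹ • (a * (y * c) * c) = a * (y * c)
    rw [mul_assoc, mul_assoc y, hc, mul_smul_comm, mul_smul_comm, inv_smul_smul₀ hα]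
  rw [← hf_restrict]
  exact (LinearMap.trace_restrict_eq_of_forall_mem I f hf_mem).trans (map_smul _ _ _)

end QuasiIdempotent

section GroupAlgebra

variable {k G : Type*} [Group G] [Fintype G]

theorem trace_mulLeftRight_single [CommSemiring k] (g : G) (y : MonoidAlgebra k G) :
    trace k _ (mulLeftRight k (MonoidAlgebra.single g 1, y))
      = ∑ h : G, y.coeff (h⁻¹ * g⁻¹ * h) := by
  classical
  rw [LinearMap.trace_eq_matrix_trace k (MonoidAlgebra.basis G k), Matrix.trace]
  refine sum_congr rfl fun h _ => ?_
  rw [Matrix.diag_apply, LinearMap.toMatrix_apply]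
  change (MonoidAlgebra.single g 1 * MonoidAlgebra.single h 1 * y).coeff h = _
  simp [mul_assoc]

variable [Field k] {c : MonoidAlgebra k G} {α : k}

theorem ne_zero_of_mul_self_eq_smul [NeZero (Fintype.card G : k)] (hc : c * c = α • c)
    (h1 : c.coeff 1 ≠ 0) : α ≠ 0 := by
  rintro rfl
  have hnil : IsNilpotent (mulLeftRight k (MonoidAlgebra.single (1 : G) 1, c)) := by
    refine ⟨2, LinearMap.ext fun x => ?_⟩
    simp [pow_two, mul_assoc, hc, ← MonoidAlgebra.one_def]
  have htrace := (LinearMap.isNilpotent_trace_of_isNilpotent hnil).eq_zero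
  simp [trace_mulLeftRight_single, h1, NeZero.ne] at htrace

theorem character_ofModule'_div_one [NeZero (Fintype.card G : k)] (hc : c * c = α • c)
    (h1 : c.coeff 1 = 1) (g : G) :
    (Representation.ofModule' (k := k) (Ideal.span {c} : Ideal (MonoidAlgebra k G))).character g /
      (Representation.ofModule' (k := k) (Ideal.span {c} : Ideal (MonoidAlgebra k G))).character
        (1 : G)
      = (∑ h : G, c.coeff (h⁻¹ * g⁻¹ * h)) / Fintype.card G := by
  have hα : α ≠ 0 := ne_zero_of_mul_self_eq_smul hc (h1 ▸ one_ne_zero)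
  have hchar (g : G) : (Representation.ofModule' (k := k)
      (Ideal.span {c} : Ideal (MonoidAlgebra k G))).character g
        = α⁻¹ * ∑ h : G, c.coeff (h⁻¹ * g⁻¹ * h) :=
    (trace_lsmul_span_singleton hα hc _).trans
      (congrArg (α⁻¹ * ·) (trace_mulLeftRight_single g c))
  rw [hchar, hchar, mul_div_mul_left _ _ (inv_ne_zero hα)]
  simp [h1]

end GroupAlgebra

/-- The elements of the group algebra on which `C` acts from the left by the sign character `ε` and
`R` acts trivially from the right. When `C` and `R` are the column and the row stabilizer of a Young
diagram, they are the multiples of the Young symmetrizer. -/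
def IsSemiinvariant {k G : Type*} [CommRing k] [Group G] (ε : G →* ℤˣ) (C R : Subgroup G)
    (x : MonoidAlgebra k G) : Prop :=
  (∀ q ∈ C, MonoidAlgebra.single q 1 * x = ((ε q : ℤ) : k) • x) ∧
    ∀ p ∈ R, x * MonoidAlgebra.single p 1 = x

namespace IsSemiinvariant

variable {k G : Type*} [CommRing k] [Group G] {ε : G →* ℤˣ} {C R : Subgroup G}
  {x y : MonoidAlgebra k G}

theorem mul (hx : IsSemiinvariant ε C R x) (hy : IsSemiinvariant ε C R y) :
    IsSemiinvariant ε C R (x * y) :=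
  ⟨fun q hq => by rw [← mul_assoc, hx.1 q hq, smul_mul_assoc],
    fun p hp => by rw [mul_assoc, hy.2 p hp]⟩

theorem coeff_mul_left (hx : IsSemiinvariant ε C R x) {q : G} (hq : q ∈ C) (w : G) :
    x.coeff (q * w) = ((ε q : ℤ) : k) * x.coeff w := by
  simpa using congrArg (fun y => y.coeff w) (hx.1 q⁻¹ (C.inv_mem hq))

theorem coeff_mul_right (hx : IsSemiinvariant ε C R x) {p : G} (hp : p ∈ R) (w : G) :
    x.coeff (w * p) = x.coeff w := by
  simpa using congrArg (fun y => y.coeff w) (hx.2 p⁻¹ (R.inv_mem hp))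

theorem coeff_eq_zero [IsAddTorsionFree k] (hx : IsSemiinvariant ε C R x) {p q w : G} (hq : q ∈ C)
    (hp : p ∈ R) (hε : ε q = -1) (hqp : q * w = w * p) : x.coeff w = 0 := by
  have hneg : -x.coeff w = x.coeff w := by
    simpa [hε, hx.coeff_mul_right hp] using
      (hx.coeff_mul_left hq w).symm.trans (congrArg _ hqp)
  exact self_eq_neg.1 hneg.symm

theorem eq_smul [IsAddTorsionFree k] (hx : IsSemiinvariant ε C R x) (hy : IsSemiinvariant ε C R y)
    (hG : ∀ w, (∃ q ∈ C, ∃ p ∈ R, w = q * p) ∨ ∃ q ∈ C, ∃ p ∈ R, ε q = -1 ∧ q * w = w * p)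
    (h1 : y.coeff 1 = 1) : x = x.coeff 1 • y := by
  ext w
  rw [MonoidAlgebra.coeff_smul, Finsupp.smul_apply, smul_eq_mul]
  obtain ⟨q, hq, p, hp, rfl⟩ | ⟨q, hq, p, hp, hε, hqp⟩ := hG w
  · rw [hx.coeff_mul_right hp, hy.coeff_mul_right hp, ← mul_one q, hx.coeff_mul_left hq,
      hy.coeff_mul_left hq, h1]
    ring
  · rw [hx.coeff_eq_zero hq hp hε hqp, hy.coeff_eq_zero hq hp hε hqp, mul_zero]

end IsSemiinvariant

section FiberStabilizer

variable {α β γ : Type*}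

/-- The permutations that preserve every fiber of `f`, i.e. a Young subgroup of `Perm α`. -/
def fiberStabilizer (f : α → β) : Subgroup (Perm α) where
  carrier := {σ | ∀ a, f (σ a) = f a}
  mul_mem' hσ hτ a := (hσ _).trans (hτ a)
  one_mem' _ := rfl
  inv_mem' {σ} hσ a := by simpa using (hσ (σ⁻¹ a)).symm

theorem mem_fiberStabilizer {f : α → β} {σ : Perm α} :
    σ ∈ fiberStabilizer f ↔ ∀ a, f (σ a) = f a :=
  Iff.rfl

theorem swap_mem_fiberStabilizer [DecidableEq α] {f : α → β} {a b : α} (h : f a = f b) :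
    swap a b ∈ fiberStabilizer f :=
  fun _ => apply_swap_eq_self h _

theorem fiberStabilizer_inf_eq_bot {f : α → β} {g : α → γ}
    (hfg : Function.Injective fun a => (f a, g a)) :
    fiberStabilizer f ⊓ fiberStabilizer g = ⊥ :=
  (Subgroup.eq_bot_iff_forall _).2 fun _ hσ => Equiv.ext fun a => hfg (Prod.ext (hσ.1 a) (hσ.2 a))

end FiberStabilizer

section Boxes

variable (μ : YoungDiagram)

/-- The row index of a box, as a function on the boxes. -/
abbrev rowIndex (x : Box μ) : ℕ := x.1.1

/-- The column index of a box, as a function on the boxes. -/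
abbrev colIndex (x : Box μ) : ℕ := x.1.2

theorem card_box : Fintype.card (Box μ) = μ.card :=
  Fintype.card_coe _

variable {μ}

theorem rowIndex_colIndex_injective :
    Function.Injective fun x : Box μ => (rowIndex μ x, colIndex μ x) :=
  Subtype.val_injective

theorem mem_rowStabilizer {σ : Perm (Box μ)} :
    σ ∈ rowStabilizer μ ↔ σ ∈ fiberStabilizer (rowIndex μ) := by
  simp [rowStabilizer, mem_fiberStabilizer]

theorem mem_colStabilizer {σ : Perm (Box μ)} :
    σ ∈ colStabilizer μ ↔ σ ∈ fiberStabilizer (colIndex μ) := by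
  simp [colStabilizer, mem_fiberStabilizer]

theorem card_filter_col_row_lt (m j : ℕ) :
    #{x : Box μ | colIndex μ x = j ∧ rowIndex μ x < m} = min m (μ.colLen j) := by
  rw [← card_range (min m _)]
  refine card_nbij (rowIndex μ) (fun x hx => ?_) (fun x hx y hy hxy => ?_) fun i hi => ?_
  · obtain ⟨rfl, hm⟩ : colIndex μ x = j ∧ rowIndex μ x < m := by simpa using hx
    simpa [hm] using YoungDiagram.mem_iff_lt_colLen.1 x.2
  · simp only [coe_filter, mem_univ, true_and, Set.mem_ofPred_eq] at hx hy
    exact rowIndex_colIndex_injective (Prod.ext hxy (hx.1.trans hy.1.symm))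
  · obtain ⟨hm, hj⟩ : i < m ∧ i < μ.colLen j := by simpa using hi
    exact ⟨⟨(i, j), YoungDiagram.mem_iff_lt_colLen.2 hj⟩, by simpa using hm, rfl⟩

theorem card_filter_eq_sum_columns (P : Box μ → Prop) [DecidablePred P] :
    #{x | P x} = ∑ j ∈ univ.image (colIndex μ), #{x | colIndex μ x = j ∧ P x} := by
  rw [card_eq_sum_card_fiberwise fun x _ => mem_image_of_mem (colIndex μ) (mem_univ x)]
  simp only [filter_filter, and_comm]

/-- Column by column, the left side is at most the right side; summed over all columns, the two
agree because `u` is a permutation of the boxes. -/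
theorem card_filter_col_row_apply_lt {u : Perm (Box μ)}
    (hu : Function.Injective fun x => (rowIndex μ (u x), colIndex μ x)) (m : ℕ) (y : Box μ) :
    #{x | colIndex μ x = colIndex μ y ∧ rowIndex μ (u x) < m}
      = min m (μ.colLen (colIndex μ y)) := by
  have hle (j : ℕ) : #{x | colIndex μ x = j ∧ rowIndex μ (u x) < m}
      ≤ #{x | colIndex μ x = j ∧ rowIndex μ x < m} := by
    rw [card_filter_col_row_lt]
    refine le_min ?_ ?_
    · rw [← card_range m]
      refine card_le_card_of_injOn (fun x => rowIndex μ (u x)) (fun x hx => ?_)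
        fun x hx y hy hxy => ?_
      · simpa using (mem_filter.1 hx).2.2
      · exact hu (Prod.ext hxy ((mem_filter.1 hx).2.1.trans (mem_filter.1 hy).2.1.symm))
    · refine (card_le_card fun x hx => ?_).trans_eq
        ((card_filter_col_row_lt (μ.colLen j) j).trans (min_self _))
      obtain ⟨rfl, -⟩ : colIndex μ x = j ∧ _ := by simpa using hx
      simpa using YoungDiagram.mem_iff_lt_colLen.1 x.2
  have htotal : #{x | rowIndex μ (u x) < m} = #{x | rowIndex μ x < m} :=
    card_equiv u fun x => by simp
  rw [card_filter_eq_sum_columns, card_filter_eq_sum_columns (rowIndex μ · < m),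
    sum_eq_sum_iff_of_le fun j _ => hle j] at htotal
  rw [htotal _ (mem_image_of_mem _ (mem_univ y)), card_filter_col_row_lt]

theorem exists_eq_row_mul_col {u : Perm (Box μ)}
    (hu : Function.Injective fun x => (rowIndex μ (u x), colIndex μ x)) :
    ∃ p ∈ fiberStabilizer (rowIndex μ), ∃ q ∈ fiberStabilizer (colIndex μ), u = p * q := by
  have hmem (x : Box μ) : (rowIndex μ (u x), colIndex μ x) ∈ μ.cells := by
    set m := μ.colLen (colIndex μ x) with hm
    have hsub : ({y | colIndex μ y = colIndex μ x ∧ rowIndex μ (u y) < m} : Finset (Box μ)) ⊆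
        ({y | colIndex μ y = colIndex μ x ∧ rowIndex μ y < m} : Finset (Box μ)) := by
      intro y hy
      obtain ⟨hcol, -⟩ := (mem_filter.1 hy).2
      exact mem_filter.2
        ⟨mem_univ _, hcol, hm ▸ hcol ▸ YoungDiagram.mem_iff_lt_colLen.1 y.2⟩
    have hcard := (card_filter_col_row_lt m (colIndex μ x)).trans
      (card_filter_col_row_apply_lt hu m x).symm
    have hx : x ∈ ({y | colIndex μ y = colIndex μ x ∧ rowIndex μ y < m} : Finset (Box μ)) :=
      mem_filter.2 ⟨mem_univ _, rfl, YoungDiagram.mem_iff_lt_colLen.1 x.2⟩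
    rw [← eq_of_subset_of_card_le hsub hcard.le] at hx
    exact YoungDiagram.mem_iff_lt_colLen.2 (mem_filter.1 hx).2.2
  let q : Perm (Box μ) := Equiv.ofBijective
    (fun x => ⟨(rowIndex μ (u x), colIndex μ x), hmem x⟩)
    (Finite.injective_iff_bijective.1 fun x y h => hu (congrArg Subtype.val h))
  refine ⟨u * q⁻¹, fun x => ?_, q, fun _ => rfl, by simp⟩
  calc rowIndex μ (u (q⁻¹ x)) = rowIndex μ (q (q⁻¹ x)) := rfl
    _ = rowIndex μ x := by simp

theorem eq_col_mul_row_or_exists_mul_eq_mul (w : Perm (Box μ)) :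
    (∃ q ∈ fiberStabilizer (colIndex μ), ∃ p ∈ fiberStabilizer (rowIndex μ), w = q * p) ∨
      ∃ q ∈ fiberStabilizer (colIndex μ), ∃ p ∈ fiberStabilizer (rowIndex μ),
        Perm.sign q = -1 ∧ q * w = w * p := by
  by_cases hw : Function.Injective fun x => (rowIndex μ (w⁻¹ x), colIndex μ x)
  · obtain ⟨p, hp, q, hq, hpq⟩ := exists_eq_row_mul_col hw
    exact .inl ⟨q⁻¹, inv_mem hq, p⁻¹, inv_mem hp, by rw [← mul_inv_rev, ← hpq, inv_inv]⟩
  · obtain ⟨x, y, hxy, hne⟩ := Function.not_injective_iff.1 hw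
    obtain ⟨hrow, hcol⟩ := Prod.ext_iff.1 hxy
    exact .inr ⟨swap x y, swap_mem_fiberStabilizer hcol, swap (w⁻¹ x) (w⁻¹ y),
      swap_mem_fiberStabilizer hrow, Perm.sign_swap hne, swap_mul_eq_mul_swap w x y⟩

end Boxes

section YoungSymmetrizer

variable {μ : YoungDiagram}

theorem isSemiinvariant_youngSymmetrizer :
    IsSemiinvariant Perm.sign (fiberStabilizer (colIndex μ)) (fiberStabilizer (rowIndex μ))
      (youngSymmetrizer μ) := by
  constructor
  · intro q hq
    rw [youngSymmetrizer, ← mul_assoc, ← smul_mul_assoc, colAntisymmetrizer, mul_sum, smul_sum]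
    congr 1
    refine sum_equiv (Equiv.mulLeft q) (fun σ => ?_) fun σ _ => ?_
    · simp [mem_colStabilizer, Subgroup.mul_mem_cancel_left _ hq]
    · rcases Int.units_eq_one_or (Perm.sign q) with h | h <;> simp [h]
  · intro p hp
    rw [youngSymmetrizer, mul_assoc, rowSymmetrizer, sum_mul]
    congr 1
    refine sum_equiv (Equiv.mulRight p) (fun σ => ?_) fun σ _ => by simp
    simp [mem_rowStabilizer, Subgroup.mul_mem_cancel_right _ hp]

open Classical in
theorem coeff_inv_youngSymmetrizer (w : Perm (Box μ)) :
    (youngSymmetrizer μ).coeff w⁻¹ = ∑ p : Perm (Box μ),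
      if p ∈ fiberStabilizer (rowIndex μ) ∧ p * w ∈ fiberStabilizer (colIndex μ) then
        ((Perm.sign (p * w) : ℤ) : ℂ) else 0 := by
  have hcol (p : Perm (Box μ)) :
      ∑ q ∈ colStabilizer μ, (MonoidAlgebra.single q ((Perm.sign q : ℤ) : ℂ) *
        MonoidAlgebra.single p 1).coeff w⁻¹
        = if p * w ∈ fiberStabilizer (colIndex μ) then ((Perm.sign (p * w) : ℤ) : ℂ) else 0 := by
    simp only [MonoidAlgebra.single_mul_single, MonoidAlgebra.coeff_single, Finsupp.single_apply,
      mul_one, ← eq_mul_inv_iff_mul_eq, ← mul_inv_rev, sum_ite_eq', mem_colStabilizer, inv_mem_iff,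
      Perm.sign_inv]
  rw [youngSymmetrizer, colAntisymmetrizer, rowSymmetrizer, sum_mul_sum, sum_comm]
  simp only [MonoidAlgebra.coeff_sum, Finsupp.finsetSum_apply, hcol, ite_and, ← mem_rowStabilizer,
    sum_ite_mem, univ_inter]

theorem coeff_one_youngSymmetrizer : (youngSymmetrizer μ).coeff 1 = 1 := by
  classical
  rw [← inv_one, coeff_inv_youngSymmetrizer, sum_eq_single 1]
  · simp [one_mem]
  · rintro p - hp
    refine if_neg fun h => hp ?_
    rwa [mul_one, ← Subgroup.mem_inf, fiberStabilizer_inf_eq_bot rowIndex_colIndex_injective] at h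
  · simp

theorem youngSymmetrizer_mul_self :
    youngSymmetrizer μ * youngSymmetrizer μ
      = (youngSymmetrizer μ * youngSymmetrizer μ).coeff 1 • youngSymmetrizer μ :=
  (isSemiinvariant_youngSymmetrizer.mul isSemiinvariant_youngSymmetrizer).eq_smul
    isSemiinvariant_youngSymmetrizer eq_col_mul_row_or_exists_mul_eq_mul coeff_one_youngSymmetrizer

theorem chi_eq_sum_coeff_div (g : Perm (Fin μ.card)) :
    chi μ g = (∑ h : Perm (Box μ), (youngSymmetrizer μ).coeff
      (h⁻¹ * ((numbering μ).permCongr g)⁻¹ * h)) / (μ.card.factorial : ℂ) := by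
  have h1 : (numbering μ).permCongr 1 = 1 := map_one (numbering μ).permCongrHom
  have hrho (g : Perm (Fin μ.card)) :
      (rho μ).character g = (Representation.ofModule' (spechtModule μ)).character
        ((numbering μ).permCongr g) := rfl
  rw [chi, hrho, hrho, h1, character_ofModule'_div_one youngSymmetrizer_mul_self
    coeff_one_youngSymmetrizer, Fintype.card_perm, card_box]

end YoungSymmetrizer

theorem card_nsmul_sum_smul {G X M : Type*} [Group G] [Fintype G] [Fintype X] [MulAction G X]
    [MulAction.IsPretransitive G X] [AddCommMonoid M] (F : X → M) (x : X) :
    Fintype.card X • ∑ g : G, F (g • x) = Fintype.card G • ∑ y, F y := by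
  have hconst (y : X) : ∑ g : G, F (g • y) = ∑ g : G, F (g • x) := by
    obtain ⟨h, rfl⟩ := MulAction.exists_smul_eq G x y
    exact Fintype.sum_equiv (Equiv.mulRight h) _ _ fun g => by simp [mul_smul]
  calc Fintype.card X • ∑ g : G, F (g • x) = ∑ y, ∑ g : G, F (g • y) := by
        simp only [hconst, sum_const, card_univ]
    _ = ∑ g : G, ∑ y, F y := by
        rw [sum_comm]
        exact sum_congr rfl fun g _ => Equiv.sum_comp (MulAction.toPerm g) F
    _ = Fintype.card G • ∑ y, F y := by rw [sum_const, card_univ]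

section ViaFintypeEmbedding

variable {α β γ δ : Type*} [Fintype α] [DecidableEq β]

theorem viaFintypeEmbedding_mul (σ τ : Perm α) (f : α ↪ β) :
    (σ * τ).viaFintypeEmbedding f = σ.viaFintypeEmbedding f * τ.viaFintypeEmbedding f :=
  (Perm.extendDomain_mul _ _ _).symm

theorem viaFintypeEmbedding_injective (f : α ↪ β) :
    Function.Injective fun σ : Perm α => σ.viaFintypeEmbedding f :=
  Perm.extendDomainHom_injective f.toEquivRange

theorem permCongr_viaFintypeEmbedding [DecidableEq γ] (e : β ≃ γ) (σ : Perm α) (f : α ↪ β) :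
    e.permCongr (σ.viaFintypeEmbedding f) = σ.viaFintypeEmbedding (f.trans e.toEmbedding) := by
  refine (e.forall_congr_right.1 fun b => ?_ : ∀ c, _ = _) |> Equiv.ext
  rw [permCongr_apply, symm_apply_apply]
  by_cases hb : b ∈ Set.range f
  · obtain ⟨a, rfl⟩ := hb
    rw [Perm.viaFintypeEmbedding_apply_image]
    exact (Perm.viaFintypeEmbedding_apply_image σ (f.trans e.toEmbedding) a).symm
  · rw [Perm.viaFintypeEmbedding_apply_notMem_range _ _ hb,
      Perm.viaFintypeEmbedding_apply_notMem_range]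
    simpa using hb

theorem exists_viaFintypeEmbedding_eq {f : α ↪ β} {w : Perm β}
    (hw : ∀ b ∉ Set.range f, w b = b) : ∃ σ : Perm α, σ.viaFintypeEmbedding f = w := by
  have hrange (a : α) : w (f a) ∈ Set.range f := by
    by_contra ha
    exact ha ⟨a, (w.injective (hw _ ha)).symm⟩
  choose s hs using hrange
  have hs_inj : Function.Injective s := fun a b hab =>
    f.injective (w.injective ((hs a).symm.trans ((congrArg f hab).trans (hs b))))
  refine ⟨Equiv.ofBijective s (Finite.injective_iff_bijective.1 hs_inj), Equiv.ext fun b => ?_⟩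
  by_cases hb : b ∈ Set.range f
  · obtain ⟨a, rfl⟩ := hb
    rw [Perm.viaFintypeEmbedding_apply_image]
    exact hs a
  · rw [Perm.viaFintypeEmbedding_apply_notMem_range _ _ hb, hw b hb]

theorem viaFintypeEmbedding_mem_fiberStabilizer {f : α ↪ β} {g : β → γ} {σ : Perm α} :
    σ.viaFintypeEmbedding f ∈ fiberStabilizer g ↔ σ ∈ fiberStabilizer (g ∘ f) := by
  refine ⟨fun h a => by simpa using h (f a), fun h b => ?_⟩
  by_cases hb : b ∈ Set.range f
  · obtain ⟨a, rfl⟩ := hb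
    simpa using h a
  · rw [Perm.viaFintypeEmbedding_apply_notMem_range _ _ hb]

theorem exists_viaFintypeEmbedding_eq_of_mem_fiberStabilizer {g : β → γ} {h : β → δ}
    (hgh : Function.Injective fun b => (g b, h b)) {f : α ↪ β} {π : Perm α} {w : Perm β}
    (hg : w ∈ fiberStabilizer g) (hh : w * π.viaFintypeEmbedding f ∈ fiberStabilizer h) :
    ∃ σ : Perm α, σ.viaFintypeEmbedding f = w := by
  refine exists_viaFintypeEmbedding_eq fun b hb => hgh (Prod.ext (hg b) ?_)
  simpa [Perm.viaFintypeEmbedding_apply_notMem_range _ _ hb] using hh b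

end ViaFintypeEmbedding

open Classical in
theorem sum_sign_fiberStabilizer_eq_zero {α β γ R : Type*} [Fintype α] [DecidableEq α] [Ring R]
    {g : α → β} {h : α → γ} (hgh : ¬ Function.Injective fun a => (g a, h a)) (π : Perm α) :
    ∑ σ : Perm α, (if σ ∈ fiberStabilizer g ∧ σ * π ∈ fiberStabilizer h then
      ((Perm.sign (σ * π) : ℤ) : R) else 0) = 0 := by
  obtain ⟨a, b, hab, hne⟩ := Function.not_injective_iff.1 hgh
  obtain ⟨hg, hh⟩ : g a = g b ∧ h a = h b := Prod.ext_iff.1 hab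
  refine sum_involution (fun σ _ => swap a b * σ) (fun σ _ => ?_) (fun σ _ _ => ?_)
    (fun _ _ => mem_univ _) fun σ _ => by simp
  · simp only [mul_assoc, Subgroup.mul_mem_cancel_left _ (swap_mem_fiberStabilizer hg),
      Subgroup.mul_mem_cancel_left _ (swap_mem_fiberStabilizer hh), Perm.sign_mul (swap a b),
      Perm.sign_swap hne]
    split_ifs <;> simp
  · simpa [swap_eq_one_iff] using hne

section Labelling

variable {α : Type*} {μ : YoungDiagram}

/-- The maps `f` from letters to boxes of `μ` such that `f (σ a)` is always in the row of `f a` and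
`f (τ a)` is always in the column of `f a`. With `τ = σ * π` they are what the normalized character
at `π` counts. -/
def labellings (μ : YoungDiagram) (σ τ : Perm α) : Set (α → Box μ) :=
  {f | σ ∈ fiberStabilizer (rowIndex μ ∘ f) ∧ τ ∈ fiberStabilizer (colIndex μ ∘ f)}

open Classical in
theorem coeff_inv_viaFintypeEmbedding_youngSymmetrizer [Fintype α] [DecidableEq α]
    (π : Perm α) (f : α ↪ Box μ) : (youngSymmetrizer μ).coeff (π.viaFintypeEmbedding f)⁻¹
      = ∑ σ : Perm α, if ⇑f ∈ labellings μ σ (σ * π) then ((Perm.sign (σ * π) : ℤ) : ℂ) else 0 := by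
  rw [coeff_inv_youngSymmetrizer]
  refine (Fintype.sum_of_injective _ (viaFintypeEmbedding_injective f) _ _ (fun w hw => ?_)
    fun σ => ?_).symm
  · exact if_neg fun h => hw
      (exists_viaFintypeEmbedding_eq_of_mem_fiberStabilizer rowIndex_colIndex_injective h.1 h.2)
  · simp only [← viaFintypeEmbedding_mul, viaFintypeEmbedding_mem_fiberStabilizer,
      Perm.viaFintypeEmbedding_sign]
    exact if_congr Iff.rfl rfl rfl

variable {l : ℕ}

theorem normalizedCharacter_eq_sum_embedding (hl : l ≤ μ.card) (π : Perm (Fin l)) :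
    normalizedCharacter μ hl π
      = ∑ f : Fin l ↪ Box μ, (youngSymmetrizer μ).coeff (π.viaFintypeEmbedding f)⁻¹ := by
  let f₀ : Fin l ↪ Box μ := (Fin.castLEEmb hl).trans (numbering μ).toEmbedding
  have hconj (h : Perm (Box μ)) :
      h⁻¹ * ((numbering μ).permCongr (π.viaFintypeEmbedding (Fin.castLEEmb hl)))⁻¹ * h
        = (π.viaFintypeEmbedding (h⁻¹ • f₀))⁻¹ := by
    calc _ = (h⁻¹.permCongr ((numbering μ).permCongr (π.viaFintypeEmbedding _)))⁻¹ := rfl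
      _ = _ := by rw [permCongr_viaFintypeEmbedding, permCongr_viaFintypeEmbedding]; rfl
  have := Perm.isMultiplyPretransitive (Box μ) l
  have haverage := card_nsmul_sum_smul (G := Perm (Box μ))
    (fun f => (youngSymmetrizer μ).coeff (π.viaFintypeEmbedding f)⁻¹) f₀
  rw [Fintype.card_embedding_eq, Fintype.card_perm, Fintype.card_fin, card_box, nsmul_eq_mul,
    nsmul_eq_mul] at haverage
  rw [normalizedCharacter, chi_eq_sum_coeff_div, ← mul_div_assoc,
    div_eq_iff (Nat.cast_ne_zero.2 (Nat.factorial_ne_zero _)), mul_comm (∑ _, _), ← haverage]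
  congr 1
  exact Fintype.sum_equiv (Equiv.inv _) _ _ fun h => congrArg _ (hconj h)

theorem normalizedCharacter_eq_sum (hl : l ≤ μ.card) (π : Perm (Fin l)) :
    normalizedCharacter μ hl π
      = ∑ σ : Perm (Fin l),
          ((Perm.sign (σ * π) : ℤ) : ℂ) * (Nat.card (labellings μ σ (σ * π)) : ℂ) := by
  classical
  rw [normalizedCharacter_eq_sum_embedding]
  simp only [coeff_inv_viaFintypeEmbedding_youngSymmetrizer]
  refine (Fintype.sum_of_injective _ DFunLike.coe_injective _ (fun f : Fin l → Box μ =>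
    ∑ σ : Perm (Fin l), if f ∈ labellings μ σ (σ * π) then ((Perm.sign (σ * π) : ℤ) : ℂ) else 0)
    (fun f hf => ?_) fun _ => rfl).trans (sum_comm.trans ?_)
  · have hinj : ¬ Function.Injective fun a => (rowIndex μ (f a), colIndex μ (f a)) := fun h =>
      hf ⟨⟨f, fun a b hab => h (by simp only [hab])⟩, rfl⟩
    convert sum_sign_fiberStabilizer_eq_zero hinj π
    rfl
  · refine sum_congr rfl fun σ _ => ?_
    rw [← sum_filter, sum_const, nsmul_eq_mul, mul_comm, Nat.card_eq_fintype_card,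
      Fintype.card_subtype]

end Labelling

section Cycles

variable {α X : Type*}

theorem mem_fiberStabilizer_iff_setoid_le_ker {σ : Perm α} {k : α → X} :
    σ ∈ fiberStabilizer k ↔ Perm.SameCycle.setoid σ ≤ Setoid.ker k := by
  refine ⟨fun h a b => ?_, fun h a => (h (Perm.SameCycle.refl σ a).apply_right).symm⟩
  rintro ⟨n, rfl⟩
  exact (zpow_mem h n a).symm

/-- The functions invariant under `σ` are the functions on the cycles of `σ`. -/
def invariantFunctionEquiv (σ : Perm α) :
    {k : α → X // σ ∈ fiberStabilizer k} ≃ (Quotient (Perm.SameCycle.setoid σ) → X) :=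
  (Equiv.subtypeEquivRight fun _ => mem_fiberStabilizer_iff_setoid_le_ker).trans
    (Setoid.liftEquiv _)

variable [Fintype α] [DecidableEq α] (τ : Perm α)

/-- The permutation that agrees with `τ` on the cycle `c` and fixes all other letters. It is `1`
when `c` is a fixed point, a cycle that `Equiv.Perm.cycleFactorsFinset` leaves out. -/
def cyclePerm : Quotient (Perm.SameCycle.setoid τ) → Perm α :=
  Quotient.lift τ.cycleOf fun _ _ h => Perm.SameCycle.cycleOf_eq h

theorem cyclePerm_mk_eq_one_iff {a : α} : cyclePerm τ (Quotient.mk _ a) = 1 ↔ τ a = a :=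
  Perm.cycleOf_eq_one_iff τ

open Classical in
theorem card_filter_cyclePerm_eq_one :
    #{c | cyclePerm τ c = 1} = #{a | τ a = a} := by
  refine (card_nbij (Quotient.mk _) (fun a ha => ?_) (fun a ha b _ h => ?_) fun c hc => ?_).symm
  · simpa [cyclePerm_mk_eq_one_iff] using ha
  · exact (Quotient.exact h : τ.SameCycle a b).eq_of_left (mem_filter.1 ha).2
  · obtain ⟨a, rfl⟩ := Quotient.exists_rep c
    exact ⟨a, by simpa [cyclePerm_mk_eq_one_iff] using hc, rfl⟩

open Classical in
theorem card_filter_cyclePerm_ne_one :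
    #{c | cyclePerm τ c ≠ 1} = #τ.cycleFactorsFinset := by
  refine card_nbij (cyclePerm τ) (fun c hc => ?_) (fun c hc d _ h => ?_) fun ρ hρ => ?_
  · obtain ⟨a, rfl⟩ := Quotient.exists_rep c
    have ha : τ a ≠ a := (cyclePerm_mk_eq_one_iff τ).not.1 (mem_filter.1 hc).2
    exact Perm.cycleOf_mem_cycleFactorsFinset_iff.2 (Perm.mem_support.2 ha)
  · obtain ⟨a, rfl⟩ := Quotient.exists_rep c
    obtain ⟨b, rfl⟩ := Quotient.exists_rep d
    have ha : τ a ≠ a := (cyclePerm_mk_eq_one_iff τ).not.1 (mem_filter.1 hc).2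
    have hab : a ∈ (τ.cycleOf b).support := (congrArg Perm.support h : _ = _) ▸
      Perm.mem_support_cycleOf_iff.2 ⟨Perm.SameCycle.refl τ a, Perm.mem_support.2 ha⟩
    exact Quotient.sound (Perm.mem_support_cycleOf_iff.1 hab).1.symm
  · have hcycle : ρ.IsCycle := (Perm.mem_cycleFactorsFinset_iff.1 hρ).1
    obtain ⟨a, ha⟩ := hcycle.nonempty_support
    have hρa : ρ = cyclePerm τ (Quotient.mk _ a) := Perm.cycle_is_cycleOf ha hρ
    exact ⟨Quotient.mk _ a, mem_filter.2 ⟨mem_univ _, hρa ▸ hcycle.ne_one⟩, hρa.symm⟩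

theorem sign_eq_neg_one_pow_card_add_card_cycles :
    Perm.sign τ = (-1) ^ (Fintype.card α + Nat.card (Quotient (Perm.SameCycle.setoid τ))) := by
  classical
  have hletters : Fintype.card α = #{a | τ a = a} + #τ.support :=
    (card_filter_add_card_filter_not _).symm
  have hcycles : Nat.card (Quotient (Perm.SameCycle.setoid τ))
      = #{a | τ a = a} + #τ.cycleFactorsFinset := by
    rw [← card_filter_cyclePerm_eq_one, ← card_filter_cyclePerm_ne_one,
      card_filter_add_card_filter_not, card_univ, Nat.card_eq_fintype_card]
  have hcycleType : τ.cycleType.card = #τ.cycleFactorsFinset := by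
    rw [Perm.cycleType_def, Multiset.card_map, card_val]
  rw [Perm.sign_of_cycleType, Perm.sum_cycleType, hcycleType, hletters, hcycles,
    add_add_add_comm, pow_add _ (_ + _), Even.neg_one_pow ⟨_, rfl⟩, one_mul]

end Cycles

section ColoredPerm

variable {l r : ℕ}

/-- The colored permutation given by a coloring of the cycles. -/
def coloredPermMk (σ : Perm (Fin l)) (φ : Cycles σ → Fin r) : ColoredPerm l r :=
  ⟨(σ, fun a => φ (Quotient.mk _ a)), fun _ _ h => congrArg φ (Quotient.sound h)⟩

theorem color_coloredPermMk (σ : Perm (Fin l)) (φ : Cycles σ → Fin r) :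
    (coloredPermMk σ φ).color = φ :=
  funext fun c => Quotient.inductionOn c fun _ => rfl

theorem coloredPermMk_bijective :
    Function.Bijective fun x : Σ σ : Perm (Fin l), Cycles σ → Fin r => coloredPermMk x.1 x.2 := by
  refine ⟨fun ⟨σ, φ⟩ ⟨τ, ψ⟩ h => ?_, fun x => ⟨⟨x.perm, x.color⟩, rfl⟩⟩
  obtain rfl : σ = τ := congrArg ColoredPerm.perm h
  obtain rfl : φ = ψ :=
    (Setoid.liftEquiv _).symm.injective (Subtype.ext (congrArg (fun x => x.1.2) h))
  rfl

instance cyclesDecidableEq (σ : Perm (Fin l)) : DecidableEq (Cycles σ) := Classical.decEq _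

theorem sum_coloredPerm {M : Type*} [AddCommMonoid M] (F : ColoredPerm l r → M) :
    ∑ x, F x = ∑ σ : Perm (Fin l), ∑ φ : Cycles σ → Fin r, F (coloredPermMk σ φ) := by
  rw [← coloredPermMk_bijective.sum_comp F]
  exact Fintype.sum_sigma _

variable {q : Fin r → ℕ}

theorem forall_lt_color_mulPerm_iff (hq : Antitone q) (x : ColoredPerm l r) (π : Perm (Fin l))
    (m : Cycles (x.mulPerm π).perm → ℕ) :
    (∀ c, m c < q ((x.mulPerm π).color c)) ↔ ∀ a, m (Quotient.mk _ a) < q (x.1.2 a) := by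
  constructor
  · intro h a
    refine (h (Quotient.mk _ a)).trans_le (hq ?_)
    exact le_sup' x.1.2 (mem_filter.2 ⟨mem_univ _, Perm.SameCycle.refl _ a⟩)
  · intro h c
    obtain ⟨a, rfl⟩ := Quotient.exists_rep c
    obtain ⟨b, hb, hmax⟩ :=
      exists_mem_eq_sup' (s := univ.filter fun b => (x.perm * π).SameCycle a b)
        ⟨a, by simp [Perm.SameCycle.refl]⟩ x.1.2
    have hcolor : (x.mulPerm π).color (Quotient.mk _ a) = x.1.2 b := hmax
    rw [hcolor, Quotient.sound (show _ from (mem_filter.1 hb).2)]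
    exact h b

theorem card_invariant_lt_color (hq : Antitone q) (x : ColoredPerm l r) (π : Perm (Fin l)) :
    Nat.card {m : Fin l → ℕ // x.perm * π ∈ fiberStabilizer m ∧ ∀ a, m a < q (x.1.2 a)}
      = ∏ c : Cycles (x.mulPerm π).perm, q ((x.mulPerm π).color c) := by
  have e : {m : Fin l → ℕ // x.perm * π ∈ fiberStabilizer m ∧ ∀ a, m a < q (x.1.2 a)}
      ≃ ∀ c : Cycles (x.mulPerm π).perm, Fin (q ((x.mulPerm π).color c)) :=
    calc _ ≃ {m : {m : Fin l → ℕ // x.perm * π ∈ fiberStabilizer m} // ∀ a, m.1 a < q (x.1.2 a)} :=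
          (Equiv.subtypeSubtypeEquivSubtypeInter _ _).symm
      _ ≃ {M : Cycles (x.mulPerm π).perm → ℕ // ∀ c, M c < q ((x.mulPerm π).color c)} :=
          (invariantFunctionEquiv _).subtypeEquiv fun m =>
            (forall_lt_color_mulPerm_iff hq x π (invariantFunctionEquiv _ m)).symm
      _ ≃ ∀ c, {i // i < q ((x.mulPerm π).color c)} :=
          Equiv.subtypePiEquivPi (β := fun _ => ℕ)
            (p := fun c i => i < q ((x.mulPerm π).color c))
      _ ≃ _ := Equiv.piCongrRight fun c => Fin.equivSubtype.symm
  rw [Nat.card_congr e, Nat.card_pi]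
  simp only [Nat.card_fin]

theorem sign_mul_prod_color {R : Type*} [CommRing R] (f : Fin r → R) (x : ColoredPerm l r) :
    ((Perm.sign x.perm : ℤ) : R) * ∏ c : Cycles x.perm, f (x.color c)
      = (-1) ^ l * ∏ c : Cycles x.perm, (-f (x.color c)) := by
  rw [prod_neg, sign_eq_neg_one_pow_card_add_card_cycles, card_univ, Nat.card_eq_fintype_card,
    Fintype.card_fin]
  push_cast
  ring

end ColoredPerm

section Multirect

theorem sum_comp_left {A B C M : Type*} [Fintype A] [DecidableEq A] [Fintype B] [Fintype C]
    [DecidableEq C] [AddCommMonoid M] (g : B → C) (F : (A → C) → M) :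
    ∑ K : A → B, F (g ∘ K) = ∑ φ : A → C, (∏ a, #{b | g b = φ a}) • F φ := by
  have hfiber (φ : A → C) :
      #{K : A → B | g ∘ K = φ} = ∏ a, #{b | g b = φ a} := by
    rw [← Fintype.card_piFinset]
    congr 1
    ext K
    simp [funext_iff]
  rw [← sum_fiberwise univ (g ∘ ·)]
  refine sum_congr rfl fun φ _ => ?_
  rw [← hfiber, ← sum_const]
  exact sum_congr rfl fun K hK => congrArg F (mem_filter.1 hK).2

theorem card_filter_get_eq_count {X : Type*} [DecidableEq X] (L : List X) (x : X) :
    #{i | L.get i = x} = L.count x := by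
  simpa [List.Vector.get, eq_comm] using
    Fin.card_filter_univ_eq_vector_get_eq_count x (⟨L, rfl⟩ : List.Vector X L.length)

variable {r l : ℕ} (p q : Fin r → ℕ)

theorem exists_blockIndex :
    ∃ blockIndex : Fin (multirectRows p q).length → Fin r,
      (∀ i, (multirectRows p q).get i = q (blockIndex i)) ∧
        ∀ k, #{i | blockIndex i = k} = p k := by
  let blocks : List (Fin r) := (List.ofFn fun i => List.replicate (p i) i).flatten
  have hrows : multirectRows p q = blocks.map q := by
    simp [blocks, multirectRows, List.map_flatten, List.map_ofFn, Function.comp_def]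
  have hcount (k : Fin r) : blocks.count k = p k := by
    simp [blocks, List.count_flatten, List.map_ofFn, List.sum_ofFn, List.count_replicate]
  rw [hrows]
  refine ⟨fun i => blocks.get (i.cast (List.length_map q)), fun i => by simp, fun k => ?_⟩
  rw [← hcount, ← card_filter_get_eq_count]
  exact card_equiv (finCongr (List.length_map q)) fun i => by simp

/-- A box labelling amounts to a choice of rows and a choice of columns. -/
def labellingsOfRowLensEquiv {α : Type*} (w : List ℕ) (hw : w.SortedGE) (σ τ : Perm α) :
    labellings (YoungDiagram.ofRowLens w hw) σ τ ≃
      Σ K : {K : α → Fin w.length // σ ∈ fiberStabilizer K},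
        {m : α → ℕ // τ ∈ fiberStabilizer m ∧ ∀ a, m a < w.get (K.1 a)} where
  toFun f :=
    ⟨⟨fun a => ⟨(f.1 a).1.1, (YoungDiagram.mem_ofRowLens.1 (f.1 a).2).1⟩,
      fun a => Fin.ext (f.2.1 a)⟩,
      fun a => (f.1 a).1.2, f.2.2, fun a => (YoungDiagram.mem_ofRowLens.1 (f.1 a).2).2⟩
  invFun x :=
    ⟨fun a => ⟨(x.1.1 a, x.2.1 a), YoungDiagram.mem_ofRowLens.2 ⟨(x.1.1 a).2, x.2.2.2 a⟩⟩,
      fun a => congrArg Fin.val (x.1.2 a), x.2.2.1⟩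
  left_inv _ := rfl
  right_inv _ := rfl

theorem card_labellings_multirect (hq : Antitone q) (σ π : Perm (Fin l)) :
    Nat.card (labellings (multirect p q hq) σ (σ * π))
      = ∑ φ : Cycles σ → Fin r, (∏ b, p (φ b)) *
          ∏ c : Cycles ((coloredPermMk σ φ).mulPerm π).perm,
            q (((coloredPermMk σ φ).mulPerm π).color c) := by
  classical
  obtain ⟨blockIndex, hrows, hcard⟩ := exists_blockIndex p q
  let columnChoices (φ : Cycles σ → Fin r) : ℕ :=
    ∏ c : Cycles ((coloredPermMk σ φ).mulPerm π).perm, q (((coloredPermMk σ φ).mulPerm π).color c)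
  have (K : Fin l → Fin (multirectRows p q).length) : Finite {m : Fin l → ℕ //
      σ * π ∈ fiberStabilizer m ∧ ∀ a, m a < (multirectRows p q).get (K a)} :=
    Finite.of_injective (fun m a => (⟨m.1 a, m.2.2 a⟩ : Fin _)) fun m n hmn =>
      Subtype.ext (funext fun a => congrArg Fin.val (congrFun hmn a))
  calc Nat.card (labellings (multirect p q hq) σ (σ * π))
      = ∑ K : {K : Fin l → Fin (multirectRows p q).length // σ ∈ fiberStabilizer K},
          Nat.card {m : Fin l → ℕ // σ * π ∈ fiberStabilizer m ∧
            ∀ a, m a < (multirectRows p q).get (K.1 a)} :=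
        (Nat.card_congr (labellingsOfRowLensEquiv _ _ σ (σ * π))).trans Nat.card_sigma
    _ = ∑ K : Cycles σ → Fin (multirectRows p q).length, columnChoices (blockIndex ∘ K) := by
        refine Fintype.sum_equiv (invariantFunctionEquiv σ) _ _ fun K => ?_
        simp only [hrows]
        exact card_invariant_lt_color hq
          (coloredPermMk σ (blockIndex ∘ invariantFunctionEquiv σ K)) π
    _ = ∑ φ : Cycles σ → Fin r, (∏ b, p (φ b)) * columnChoices φ := by
        simp only [sum_comp_left blockIndex columnChoices, hcard, smul_eq_mul]

end Multirect

end

end StanleyFeray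

theorem mainTheorem9 (r : ℕ) (p q : Fin r → ℕ) (hp : ∀ i, 0 < p i) (hq : ∀ i, 0 < q i)
    (hanti : Antitone q) (l : ℕ) (hl : l ≤ (StanleyFeray.multirect p q hanti).card)
    (π : Equiv.Perm (Fin l)) :
    StanleyFeray.normalizedCharacter (StanleyFeray.multirect p q hanti) hl π =
      (-1 : ℂ) ^ l * ∑ x : StanleyFeray.ColoredPerm l r,
        (∏ b : StanleyFeray.Cycles x.perm, (p (x.color b) : ℂ)) *
          ∏ c : StanleyFeray.Cycles (x.mulPerm π).perm, (-(q ((x.mulPerm π).color c) : ℂ)) := by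
  rw [StanleyFeray.normalizedCharacter_eq_sum, StanleyFeray.sum_coloredPerm, Finset.mul_sum]
  refine Finset.sum_congr rfl fun σ _ => ?_
  rw [StanleyFeray.card_labellings_multirect, Nat.cast_sum, Finset.mul_sum, Finset.mul_sum]
  refine Finset.sum_congr rfl fun φ _ => ?_
  have hsign := StanleyFeray.sign_mul_prod_color (fun i => (q i : ℂ))
    ((StanleyFeray.coloredPermMk σ φ).mulPerm π)
  rw [StanleyFeray.color_coloredPermMk, mul_left_comm ((-1 : ℂ) ^ l), ← hsign, Nat.cast_mul,
    Nat.cast_prod, Nat.cast_prod]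
  exact mul_left_comm _ _ _
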